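/- Fix a set $\mathsf{Act}$ of actions and an infinite set $\mathsf{Var}$ of variables. \emph{Countdown formulas} are given by \[ \phi ::= x \mid \top \mid \bot \mid \phi_1\vee\phi_2 \mid \phi_1\wedge\phi_2 \mid \mu^\alpha_i\overline{x}.\overline{\phi} \mid \nu^\alpha_i\overline{x}.\overline{\phi} \mid \langle\tau\rangle\phi \mid [\tau]\phi , \] where $x\in\mathsf{Var}$, $\tau\in\mathsf{Act}$, $\alpha$ is an ordinal or $\infty$, $\overline{x}=\langle x_1,\dots,x_n\rangle$ is a tuple of pairwise distinct variables, $\overline{\phi}=\langle\phi_1,\dots,\phi_n\rangle$ is a tuple of formulas, and $1\le i\le n<\omega$. A model $\mathcal M$ is a set $M$ of points with a relation $\stackrel{\tau}{\to}\;\subseteq M\times M$ for every $\tau\in\mathsf{Act}$. For a valuation $\mathsf{val}:\mathsf{Var}\to\mathcal P(M)$ the meaning $[\![\phi]\!]^{\mathsf{val}}\subseteq M$ is defined by induction: variables, $\top$, $\bot$, $\vee$, $\wedge$ are interpreted as usual, $[\![\langle\tau\rangle\phi]\!]^{\mathsf{val}}=\{m\mid \exists n\;(m\stackrel{\tau}{\to}n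 \text{ and } n\in[\![\phi]\!]^{\mathsf{val}})\}$, $[\![[\tau]\phi]\!]^{\mathsf{val}}=\{m\mid \forall n\;(m\stackrel{\tau}{\to}n \Rightarrow n\in[\![\phi]\!]^{\mathsf{val}})\}$, and $[\![\eta^\alpha_i\overline{x}.\overline{\phi}]\!]^{\mathsf{val}}$, for $\eta\in\{\mu,\nu\}$, is the $i$-th component of $F^\alpha_\eta$, where $F$ is the monotone map on $\mathcal P(M)^n$ with $F(H_1,\dots,H_n)=([\![\phi_1]\!]^{\mathsf{val}'},\dots,[\![\phi_n]\!]^{\mathsf{val}'})$ for $\mathsf{val}'=\mathsf{val}[x_1\mapsto H_1,\dots,x_n\mapsto H_n]$. Here, for an ordinal $\alpha$, $F^\alpha_\mu=\bigvee_{\beta<\alpha}F(F^\beta_\mu)$ and $F^\alpha_\nu=\bigwedge_{\beta<\alpha}F(F^\beta_\nu)$, while $F^\infty_\mu$ and $F^\infty_\nu$ are the least and the greatest fixpoint of $F$. Two formulas $\phi,\psi$ are \emph{equivalent} if $[\![\phi]\!]^{\mathsf{val}}=[\![\psi]\!]^{\mathsf{val}}$ in every model, for every valuation. The \emph{countdown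 automaton} $\mathcal A_\phi$ of $\phi$ has as states the subformulas of $\phi$ other than its free variables, where different occurrences of the same subformula (i.e.\ different paths in the syntactic tree) are distinguished. A state $\theta_1\vee\theta_2$ or $\theta_1\wedge\theta_2$ has $\epsilon$-transitions to $\theta_1$ and to $\theta_2$; a state $\eta^\alpha_i\overline{x}.\overline{\theta}$ has one $\epsilon$-transition, to $\theta_i$; a bound variable $x$ has one $\epsilon$-transition, to $\theta_i$, where $\eta^\alpha_j(x_1,\dots,x_n).(\theta_1,\dots,\theta_n)$ is the fixpoint subformula that binds this occurrence of $x$ and $x=x_i$; states $\top$ and $\bot$ have no transitions; and $\langle\tau\rangle\theta$ and $[\tau]\theta$ have a modal transition labelled $\tau$ to $\theta$. (The owners and ranks of states and the initial counter values of $\mathcal A_\phi$ play no role below.) The formula $\phi$ is \emph{guarded} if $\mathcal A_\phi$ contains no loop without modal transitions, i.e.\ if no state can be reached from itself by a nonempty sequence of $\epsilon$-transitions. \textbf{Proposition.} For every countdown formula $\phi$ there is a guarded countdown formula $\psi$ that is equivalent to $\phi$. -/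

import Mathlib

universe u v w z

namespace CountdownCalculus

/-! ## Approximations of fixpoints, indexed by ordinals and by an extra top element -/

section Approximations

variable {A : Type z} [CompleteLattice A]

/-- The join, over all `β < α`, of `F (muApprox F β)`. -/
noncomputable def muApprox (F : A → A) (α : Ordinal.{u}) : A :=
  ⨆ β : Set.Iio α, F (muApprox F β.1)
termination_by α
decreasing_by exact β.2

/-- The meet, over all `β < α`, of `F (nuApprox F β)`. -/
noncomputable def nuApprox (F : A → A) (α : Ordinal.{u}) : A :=
  ⨅ β : Set.Iio α, F (nuApprox F β.1)
termination_by α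
decreasing_by exact β.2

/-- The two kinds of fixpoint operators. -/
inductive FixKind : Type
  | mu
  | nu

/-- The `α`-th approximation of the least (`mu`) or greatest (`nu`) fixpoint of a monotone map `F`.
The index `⊤` stands for the infinite index, at which the value is the fixpoint itself, written as
the least prefixed point, respectively the greatest postfixed point. -/
noncomputable def stage (F : A → A) : FixKind → WithTop Ordinal.{u} → A
  | .mu, ⊤ => sInf {a | F a ≤ a}
  | .nu, ⊤ => sSup {a | a ≤ F a}
  | .mu, (α : Ordinal.{u}) => muApprox F α
  | .nu, (α : Ordinal.{u}) => nuApprox F α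

theorem stage_mu_top_isLeast {F : A → A} (hF : Monotone F) :
    IsLeast {a | F a = a} (stage.{u} F .mu ⊤) :=
  OrderHom.isLeast_lfp ⟨F, hF⟩

theorem stage_nu_top_isGreatest {F : A → A} (hF : Monotone F) :
    IsGreatest {a | F a = a} (stage.{u} F .nu ⊤) :=
  OrderHom.isGreatest_gfp ⟨F, hF⟩

theorem stage_mono {F G : A → A} (hF : Monotone F) (h : ∀ a, F a ≤ G a) (η : FixKind)
    (α : WithTop Ordinal.{u}) : stage F η α ≤ stage G η α := by
  have hmu : ∀ α : Ordinal.{u}, muApprox F α ≤ muApprox G α := by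
    intro α
    induction α using WellFoundedLT.induction with
    | ind α ih =>
      rw [muApprox, muApprox]
      exact iSup_mono fun β => (hF (ih β.1 β.2)).trans (h _)
  have hnu : ∀ α : Ordinal.{u}, nuApprox F α ≤ nuApprox G α := by
    intro α
    induction α using WellFoundedLT.induction with
    | ind α ih =>
      rw [nuApprox, nuApprox]
      exact iInf_mono fun β => (hF (ih β.1 β.2)).trans (h _)
  cases η <;> cases α
  · exact sInf_le_sInf fun a ha => (h a).trans ha
  · exact hmu _
  · exact sSup_le_sSup fun a ha => le_trans (show a ≤ F a from ha) (h a)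
  · exact hnu _

end Approximations

/-! ## Syntax -/

/-- Formulas of the (vectorial) countdown calculus over actions `Act` and variables `Var`.
`fix η α x ψ i` is the fixpoint formula of kind `η` with countdown index `α`, binding the tuple `x`
of distinct variables in the tuple `ψ` of formulas, and projected to the `i`-th component. -/
inductive Formula (Act : Type v) (Var : Type w) : Type (max (u + 1) v w)
  | var (x : Var) : Formula Act Var
  | top : Formula Act Var
  | bot : Formula Act Var
  | or (φ ψ : Formula Act Var) : Formula Act Var
  | and (φ ψ : Formula Act Var) : Formula Act Var
  | fix (η : FixKind) (α : WithTop Ordinal.{u}) {n : ℕ} (x : Fin n ↪ Var)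
      (ψ : Fin n → Formula Act Var) (i : Fin n) : Formula Act Var
  | dia (τ : Act) (φ : Formula Act Var) : Formula Act Var
  | box (τ : Act) (φ : Formula Act Var) : Formula Act Var

/-! ## Semantics -/

/-- A model: a set of points with one binary relation for every action. -/
structure Model (Act : Type v) where
  Point : Type z
  step : Act → Point → Point → Prop

namespace Formula

variable {Act : Type v} {Var : Type w}

/-- The set of points at which a formula holds. `Function.extend x H val` is the valuation that maps
each `x j` to `H j` and agrees with `val` on all other variables. -/
noncomputable def sem (M : Model.{v, z} Act) :
    Formula.{u} Act Var → (Var → Set M.Point) → Set M.Point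
  | var x, val => val x
  | top, _ => Set.univ
  | bot, _ => ∅
  | or φ ψ, val => sem M φ val ∪ sem M ψ val
  | and φ ψ, val => sem M φ val ∩ sem M ψ val
  | fix η α x ψ i, val =>
      stage (fun H j => sem M (ψ j) (Function.extend x H val)) η α i
  | dia τ φ, val => {m | ∃ n, M.step τ m n ∧ n ∈ sem M φ val}
  | box τ φ, val => {m | ∀ n, M.step τ m n → n ∈ sem M φ val}

theorem extend_le_extend {B : Type z} [Preorder B] {n : ℕ} (x : Fin n ↪ Var) {H H' : Fin n → B}
    {val val' : Var → B} (hH : H ≤ H') (hval : val ≤ val') :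
    Function.extend x H val ≤ Function.extend x H' val' := by
  intro y
  by_cases hy : ∃ j, x j = y
  · obtain ⟨j, rfl⟩ := hy
    simpa [x.injective.extend_apply] using hH j
  · simpa [Function.extend_apply' _ _ _ hy] using hval y

theorem sem_mono (M : Model.{v, z} Act) (φ : Formula.{u} Act Var) : Monotone (φ.sem M) := by
  induction φ with
  | var x => exact fun _ _ h => h x
  | top => exact fun _ _ _ => le_rfl
  | bot => exact fun _ _ _ => le_rfl
  | or φ ψ h1 h2 => exact fun _ _ h => Set.union_subset_union (h1 h) (h2 h)
  | and φ ψ h1 h2 => exact fun _ _ h => Set.inter_subset_inter (h1 h) (h2 h)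
  | fix η α x ψ i ih =>
    intro val val' h
    have h1 : Monotone fun (H : Fin _ → Set M.Point) j =>
        (ψ j).sem M (Function.extend x H val) :=
      fun H H' hH j => ih j (extend_le_extend x hH le_rfl)
    exact stage_mono h1 (fun H j => ih j (extend_le_extend x le_rfl h)) η α i
  | dia τ φ ih => exact fun _ _ h m ⟨n, hn, hm⟩ => ⟨n, hn, ih h hm⟩
  | box τ φ ih => exact fun _ _ h m hm n hn => ih h (hm n hn)

/-- Two formulas are equivalent if they have the same meaning in every model under every valuation. -/
def Equivalent (φ ψ : Formula.{u} Act Var) : Prop :=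
  ∀ (M : Model.{v, z} Act) (val : Var → Set M.Point), φ.sem M val = ψ.sem M val

/-! ## Occurrences of subformulas, as paths in the syntactic tree -/

/-- The `k`-th immediate subformula, if there is one (counting from `0`). -/
def child : Formula.{u} Act Var → ℕ → Option (Formula.{u} Act Var)
  | or φ ψ, k => if k = 0 then some φ else if k = 1 then some ψ else none
  | and φ ψ, k => if k = 0 then some φ else if k = 1 then some ψ else none
  | @fix _ _ _ _ n _ ψ _, k => if h : k < n then some (ψ ⟨k, h⟩) else none
  | dia _ φ, k => if k = 0 then some φ else none
  | box _ φ, k => if k = 0 then some φ else none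
  | _, _ => none

/-- The subformula whose root is reached from the root of the formula along a path, if the path
exists. -/
def sub : Formula.{u} Act Var → List ℕ → Option (Formula.{u} Act Var)
  | φ, [] => some φ
  | φ, k :: p => (φ.child k).bind fun c => c.sub p

open Classical in
/-- If the formula is a fixpoint formula binding `y` as its `i`-th variable, the number `i`. -/
noncomputable def boundIndex (y : Var) : Formula.{u} Act Var → Option ℕ
  | fix _ _ x _ _ => if h : ∃ j, x j = y then some h.choose.1 else none
  | _ => none

/-- For an occurrence of the variable `y` at the end of the given path: the path to the `i`-th
component of the innermost fixpoint formula around that occurrence which binds `y`, where `y` is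
bound there as the `i`-th variable; `none` if the occurrence is free. -/
noncomputable def binder (y : Var) : Formula.{u} Act Var → List ℕ → Option (List ℕ)
  | _, [] => none
  | φ, k :: p =>
    match φ.child k with
    | none => none
    | some c =>
      match c.binder y p with
      | some t => some (k :: t)
      | none => (φ.boundIndex y).map fun i => [i]

/-- The variable that occurs free at the end of the path, if that is what is found there. -/
noncomputable def freeVarAt (φ : Formula.{u} Act Var) (p : List ℕ) : Option Var :=
  match φ.sub p with
  | some (var y) => if (φ.binder y p).isSome then none else some y
  | _ => none

/-- The fixpoint kind and countdown index of a fixpoint formula. -/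
def fixData : Formula.{u} Act Var → Option (FixKind × WithTop Ordinal.{u})
  | fix η α _ _ _ => some (η, α)
  | _ => none

theorem sub_append (φ : Formula.{u} Act Var) (p q : List ℕ) :
    φ.sub (p ++ q) = (φ.sub p).bind fun c => c.sub q := by
  induction p generalizing φ with
  | nil => simp [sub]
  | cons k p ih =>
    simp only [List.cons_append, sub]
    cases φ.child k with
    | none => rfl
    | some c => simpa using ih c

theorem sub_child {φ ψ : Formula.{u} Act Var} {p : List ℕ} (h : φ.sub p = some ψ) (k : ℕ) :
    φ.sub (p ++ [k]) = ψ.child k := by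
  rw [sub_append, h]
  cases hc : ψ.child k <;> simp [sub, hc]

theorem sub_binder (y : Var) (φ : Formula.{u} Act Var) (p t : List ℕ)
    (h : φ.binder y p = some t) : (φ.sub t).isSome := by
  induction p generalizing φ t with
  | nil => simp [binder] at h
  | cons k p ih =>
    simp only [binder] at h
    split at h
    · simp at h
    · rename_i c hc
      split at h
      · rename_i s hs
        obtain rfl : k :: s = t := by simpa using h
        simpa [sub, hc] using ih c s hs
      · cases φ with
        | fix η α x ψ i =>
          simp only [boundIndex] at h
          split at h
          · obtain rfl := Option.some.inj h
            simp [sub, child]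
          · simp at h
        | _ => simp [boundIndex] at h

theorem finite_sub (φ : Formula.{u} Act Var) : {p : List ℕ | (φ.sub p).isSome}.Finite := by
  have key : ∀ (φ : Formula.{u} Act Var) (N : ℕ), (∀ k, (φ.child k).isSome → k < N) →
      (∀ k c, φ.child k = some c → {p : List ℕ | (c.sub p).isSome}.Finite) →
      {p : List ℕ | (φ.sub p).isSome}.Finite := by
    intro φ N hN hc
    have hfin : (⋃ k ∈ Set.Iio N,
        (List.cons k) '' {p : List ℕ | ((φ.child k).bind fun c => c.sub p).isSome}).Finite := by
      refine (Set.finite_Iio N).biUnion fun k _ => Set.Finite.image _ ?_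
      cases h : φ.child k with
      | none => simp
      | some c => simpa using hc k c h
    refine (hfin.insert []).subset ?_
    rintro (_ | ⟨k, p⟩) hp
    · exact Set.mem_insert _ _
    · refine Set.mem_insert_of_mem _ (Set.mem_biUnion (x := k) ?_ ⟨p, hp, rfl⟩)
      apply hN
      simp only [Set.mem_ofPred_eq, sub] at hp
      cases h : φ.child k with
      | none => simp [h] at hp
      | some c => rfl
  induction φ with
  | var x => exact key _ 0 (by simp [child]) (by simp [child])
  | top => exact key _ 0 (by simp [child]) (by simp [child])
  | bot => exact key _ 0 (by simp [child]) (by simp [child])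
  | or φ ψ h1 h2 =>
    refine key _ 2 (by intro k; simp only [child]; grind) ?_
    intro k c; simp only [child]; grind
  | and φ ψ h1 h2 =>
    refine key _ 2 (by intro k; simp only [child]; grind) ?_
    intro k c; simp only [child]; grind
  | @fix η α n x ψ i h =>
    refine key _ n (by intro k; simp only [child]; grind) ?_
    intro k c hc
    simp only [child] at hc
    split at hc
    · obtain rfl := Option.some.inj hc
      exact h _
    · simp at hc
  | dia τ φ h1 =>
    refine key _ 1 (by intro k; simp only [child]; grind) ?_
    intro k c; simp only [child]; grind
  | box τ φ h1 =>
    refine key _ 1 (by intro k; simp only [child]; grind) ?_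
    intro k c; simp only [child]; grind

end Formula

/-! ## Countdown automata -/

/-- The two players of a countdown game. -/
inductive Player : Type
  | eve
  | adam

/-- Countdown automata. A rank `r` is standard if `ctrI r = ⊤`; otherwise it is nonstandard and
`ctrI r` is the initial value of its counter. In `δ`, the left summand holds the sets of
`ε`-transitions, the right one the modal transitions. The initial location is allowed to be a
variable only to cover the automaton of a formula that is just a free variable, which has no
states. -/
structure CountdownAutomaton (Act : Type v) (Var : Type w) where
  Q : Type
  finiteQ : Finite Q
  owner : Q → Player
  init : Q ⊕ Var
  δ : Q → Set (Q ⊕ Var) ⊕ (Act × (Q ⊕ Var))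
  R : Type
  finiteR : Finite R
  linearOrderR : LinearOrder R
  rankOwner : R → Player
  rank : Q → R
  ctrI : R → WithTop Ordinal.{u}

namespace CountdownAutomaton

variable {Act : Type v} {Var : Type w}

/-- There is an `ε`-transition from the state `q` to the state `q'`. -/
def EpsStep (𝒜 : CountdownAutomaton.{u} Act Var) (q q' : 𝒜.Q) : Prop :=
  ∃ S, 𝒜.δ q = Sum.inl S ∧ Sum.inl q' ∈ S

/-- An automaton is guarded if it has no loop without modal transitions. -/
def Guarded (𝒜 : CountdownAutomaton.{u} Act Var) : Prop :=
  ∀ q : 𝒜.Q, ¬ Relation.TransGen 𝒜.EpsStep q q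

end CountdownAutomaton

/-! ## The automaton of a formula -/

namespace Formula

variable {Act : Type v} {Var : Type w}

/-- States: occurrences of subformulas other than free occurrences of variables. -/
def State (φ : Formula.{u} Act Var) : Type :=
  {p : List ℕ // (φ.sub p).isSome ∧ φ.freeVarAt p = none}

/-- The location of an occurrence of a subformula: a state, or a free variable. -/
noncomputable def loc (φ : Formula.{u} Act Var) (p : List ℕ) (h : (φ.sub p).isSome) :
    φ.State ⊕ Var :=
  match hf : φ.freeVarAt p with
  | some y => Sum.inr y
  | none => Sum.inl ⟨p, h, hf⟩

theorem binder_isSome_of_state {φ : Formula.{u} Act Var} (q : φ.State) {y : Var}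
    (h : φ.sub q.1 = some (var y)) : (φ.binder y q.1).isSome := by
  have hq := q.2.2
  simp only [freeVarAt, h] at hq
  split at hq
  · assumption
  · simp at hq

/-- The transition function of the automaton of a formula. -/
noncomputable def delta (φ : Formula.{u} Act Var) (q : φ.State) :
    Set (φ.State ⊕ Var) ⊕ (Act × (φ.State ⊕ Var)) :=
  match h : φ.sub q.1 with
  | none => absurd q.2.1 (by simp [h])
  | some top => Sum.inl ∅
  | some bot => Sum.inl ∅
  | some (or _ _) => Sum.inl
      {φ.loc (q.1 ++ [0]) (by simp [sub_child h, child]),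
        φ.loc (q.1 ++ [1]) (by simp [sub_child h, child])}
  | some (and _ _) => Sum.inl
      {φ.loc (q.1 ++ [0]) (by simp [sub_child h, child]),
        φ.loc (q.1 ++ [1]) (by simp [sub_child h, child])}
  | some (dia τ _) => Sum.inr (τ, φ.loc (q.1 ++ [0]) (by simp [sub_child h, child]))
  | some (box τ _) => Sum.inr (τ, φ.loc (q.1 ++ [0]) (by simp [sub_child h, child]))
  | some (fix _ _ _ _ i) => Sum.inl {φ.loc (q.1 ++ [i.1]) (by simp [sub_child h, child])}
  | some (var y) => Sum.inl
      {φ.loc ((φ.binder y q.1).get (binder_isSome_of_state q h))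
        (sub_binder y φ q.1 _ (Option.some_get _).symm)}

/-- Eve owns disjunctions and diamonds, Adam conjunctions and boxes; the player who owns `⊥`,
respectively `⊤`, is stuck there and loses. The other choices do not matter. -/
def stateOwner (φ : Formula.{u} Act Var) (q : φ.State) : Player :=
  match φ.sub q.1 with
  | some (and _ _) => .adam
  | some (box _ _) => .adam
  | some top => .adam
  | _ => .eve

/-- Occurrences of fixpoint subformulas. -/
def FixOcc (φ : Formula.{u} Act Var) : Type :=
  {p : List ℕ // ((φ.sub p).bind fixData).isSome}

noncomputable instance (φ : Formula.{u} Act Var) : LinearOrder φ.FixOcc :=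
  inferInstanceAs (LinearOrder {p : List ℕ // ((φ.sub p).bind fixData).isSome})

theorem finite_fixOcc (φ : Formula.{u} Act Var) : Finite φ.FixOcc := by
  have := φ.finite_sub.to_subtype
  refine Finite.of_injective (β := {p : List ℕ | (φ.sub p).isSome})
    (fun r => ⟨r.1, ?_⟩) fun r s h => Subtype.ext (Subtype.mk.inj h)
  have hr := r.2
  cases h : φ.sub r.1 with
  | none => simp [h] at hr
  | some c => simp [h]

theorem finite_state (φ : Formula.{u} Act Var) : Finite φ.State := by
  have := φ.finite_sub.to_subtype
  exact Finite.of_injective (β := {p : List ℕ | (φ.sub p).isSome})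
    (fun q => ⟨q.1, q.2.1⟩) fun q s h => Subtype.ext (Subtype.mk.inj h)

/-- Ranks: a lowest rank `⊥`, and above it one rank for each occurrence of a fixpoint subformula.
The order is opposite to the lexicographic order of paths, which puts a path before its proper
extensions; so the rank of a fixpoint subformula is above those of the fixpoints inside it. -/
abbrev Rank (φ : Formula.{u} Act Var) : Type := WithBot (φ.FixOcc)ᵒᵈ

/-- Kind and countdown index of an occurrence of a fixpoint subformula. -/
def occData (φ : Formula.{u} Act Var) (r : φ.FixOcc) : FixKind × WithTop Ordinal.{u} :=
  ((φ.sub r.1).bind fixData).get r.2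

/-- The rank of a least fixpoint belongs to Eve, that of a greatest fixpoint to Adam. -/
def rankOwner (φ : Formula.{u} Act Var) : φ.Rank → Player
  | ⊥ => .eve
  | (r : (φ.FixOcc)ᵒᵈ) =>
    match (φ.occData (OrderDual.ofDual r)).1 with
    | .mu => .eve
    | .nu => .adam

/-- Initial counter values; the lowest rank is standard. -/
def ctrI (φ : Formula.{u} Act Var) : φ.Rank → WithTop Ordinal.{u}
  | ⊥ => ⊤
  | (r : (φ.FixOcc)ᵒᵈ) => (φ.occData (OrderDual.ofDual r)).2

/-- Immediate subformulas of a fixpoint subformula get its rank, all other states the lowest one. -/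
def stateRank (φ : Formula.{u} Act Var) (q : φ.State) : φ.Rank :=
  if h : q.1 ≠ [] ∧ ((φ.sub q.1.dropLast).bind fixData).isSome then
    ((OrderDual.toDual (⟨q.1.dropLast, h.2⟩ : φ.FixOcc) : (φ.FixOcc)ᵒᵈ) : φ.Rank)
  else ⊥

/-- The countdown automaton of a formula. -/
noncomputable def automaton (φ : Formula.{u} Act Var) : CountdownAutomaton.{u} Act Var where
  Q := φ.State
  finiteQ := φ.finite_state
  owner := φ.stateOwner
  init := φ.loc [] rfl
  δ := φ.delta
  R := φ.Rank
  finiteR := by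
    have := φ.finite_fixOcc
    have : Finite (φ.FixOcc)ᵒᵈ := this
    exact inferInstanceAs (Finite (Option (φ.FixOcc)ᵒᵈ))
  linearOrderR := inferInstance
  rankOwner := φ.rankOwner
  rank := φ.stateRank
  ctrI := φ.ctrI

/-- A formula is guarded if its automaton is. -/
def Guarded (φ : Formula.{u} Act Var) : Prop :=
  φ.automaton.Guarded

end Formula

end CountdownCalculus

/-! Consider a point `m` that enters the component `j` of a least fixpoint at some stage. If
evaluating the body at `m` calls `j` again at the same point with no modality in between, the call
refers to an earlier stage, at which `m` is not yet in `j`. It can therefore be replaced by `⊥`, and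
dually by `⊤` for a greatest fixpoint. So it suffices to remember the set `S` of components passed
since the last modality. An unguarded call of `k ∉ S` goes to a copy of `k` with memory `insert k
S`, an unguarded call of `k ∈ S` becomes the constant, and a guarded call restarts with memory
`{k}`. Every call of a copy still uses one stage, so the countdown index stays the same;
`stage_mu_unfoldMap` and `stage_nu_unfoldMap` compare the two systems stage by stage.

For this, unguarded and guarded occurrences of a variable must be told apart even across nested
fixpoints. By induction on `φ`, `IsSplitting` provides a semantics with two valuations, the first
read by unguarded and the second by guarded occurrences. The first valuation matters at a point only
through its value at that point (`PointwiseMono`), and this is what the argument above uses. A flag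
in the copies records whether a modality has been passed since the inner fixpoint was entered, and
thus which valuation its outer variables read.

Guardedness holds because `S` grows along unguarded calls. With the copies sorted by `Copy.rank`,
such calls only lead to later components. `GuardedOver` expresses this syntactically, and
`GuardedOver.guarded` derives the absence of `ε`-loops from it. -/

namespace CountdownCalculus

/-! ### Induction principles for approximations of fixpoints -/

section Approximations

variable {A B : Type z} [CompleteLattice A] [CompleteLattice B]

theorem stage_mu_induction {F : A → A} (hF : Monotone F) {p : A → Prop}
    (hSup : ∀ s : Set A, (∀ a ∈ s, p a) → p (sSup s))
    (step : ∀ a, a ≤ F a → p a → p (F a)) (α : WithTop Ordinal.{u}) :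
    p (stage F .mu α) := by
  have hSup' : ∀ s : Set A, (∀ a ∈ s, p a ∧ a ≤ F a) → p (sSup s) ∧ sSup s ≤ F (sSup s) :=
    fun s hs => ⟨hSup s fun a ha => (hs a ha).1,
      sSup_le fun a ha => (hs a ha).2.trans (hF (le_sSup ha))⟩
  -- Carrying `a ≤ F a` through the induction is what makes it available in the hypothesis `step`.
  suffices h : p (stage F .mu α) ∧ stage F .mu α ≤ F (stage F .mu α) from h.1
  cases α with
  | top =>
    exact OrderHom.lfp_induction (f := ⟨F, hF⟩) (p := fun a => p a ∧ a ≤ F a)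
      (fun a ha _ => ⟨step a ha.2 ha.1, hF ha.2⟩) hSup'
  | coe α =>
    change p (muApprox F α) ∧ muApprox F α ≤ F (muApprox F α)
    induction α using WellFoundedLT.induction with
    | ind α ih =>
      rw [muApprox]
      apply hSup'
      rintro _ ⟨β, rfl⟩
      have h := ih β.1 β.2
      exact ⟨step _ h.2 h.1, hF h.2⟩

theorem stage_nu_induction {F : A → A} (hF : Monotone F) {p : A → Prop}
    (hInf : ∀ s : Set A, (∀ a ∈ s, p a) → p (sInf s))
    (step : ∀ a, F a ≤ a → p a → p (F a)) (α : WithTop Ordinal.{u}) :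
    p (stage F .nu α) := by
  have hInf' : ∀ s : Set A, (∀ a ∈ s, p a ∧ F a ≤ a) → p (sInf s) ∧ F (sInf s) ≤ sInf s :=
    fun s hs => ⟨hInf s fun a ha => (hs a ha).1,
      le_sInf fun a ha => (hF (sInf_le ha)).trans (hs a ha).2⟩
  suffices h : p (stage F .nu α) ∧ F (stage F .nu α) ≤ stage F .nu α from h.1
  cases α with
  | top =>
    exact OrderHom.gfp_induction (f := ⟨F, hF⟩) (p := fun a => p a ∧ F a ≤ a)
      (fun a ha _ => ⟨step a ha.2 ha.1, hF ha.2⟩) hInf'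
  | coe α =>
    change p (nuApprox F α) ∧ F (nuApprox F α) ≤ nuApprox F α
    induction α using WellFoundedLT.induction with
    | ind α ih =>
      rw [nuApprox]
      apply hInf'
      rintro _ ⟨β, rfl⟩
      have h := ih β.1 β.2
      exact ⟨step _ h.2 h.1, hF h.2⟩

/-- Approximations of a product map are computed componentwise, so a relation between the stages of
two operators becomes a predicate on the stages of one. -/
theorem stage_prodMap {F : A → A} {G : B → B} (hF : Monotone F) (hG : Monotone G) (η : FixKind)
    (α : WithTop Ordinal.{u}) :
    stage (Prod.map F G) η α = (stage F η α, stage G η α) := by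
  have hmu : ∀ α : Ordinal.{u},
      muApprox (Prod.map F G) α = (muApprox F α, muApprox G α) := by
    intro α
    induction α using WellFoundedLT.induction with
    | ind α ih =>
      rw [muApprox, muApprox, muApprox]
      refine (iSup_congr fun β : Set.Iio α => congrArg (Prod.map F G) (ih β.1 β.2)).trans ?_
      simp [Prod.ext_iff, Prod.fst_iSup, Prod.snd_iSup]
  have hnu : ∀ α : Ordinal.{u},
      nuApprox (Prod.map F G) α = (nuApprox F α, nuApprox G α) := by
    intro α
    induction α using WellFoundedLT.induction with
    | ind α ih =>
      rw [nuApprox, nuApprox, nuApprox]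
      refine (iInf_congr fun β : Set.Iio α => congrArg (Prod.map F G) (ih β.1 β.2)).trans ?_
      simp [Prod.ext_iff, Prod.fst_iInf, Prod.snd_iInf]
  have hFG : Monotone (Prod.map F G) := hF.prodMap hG
  cases η <;> cases α
  · refine (stage_mu_top_isLeast.{u} hFG).unique ⟨?_, fun p hp => ⟨?_, ?_⟩⟩
    · exact Prod.ext (stage_mu_top_isLeast.{u} hF).1 (stage_mu_top_isLeast.{u} hG).1
    · exact (stage_mu_top_isLeast.{u} hF).2 (congrArg Prod.fst hp)
    · exact (stage_mu_top_isLeast.{u} hG).2 (congrArg Prod.snd hp)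
  · exact hmu _
  · refine (stage_nu_top_isGreatest.{u} hFG).unique ⟨?_, fun p hp => ⟨?_, ?_⟩⟩
    · exact Prod.ext (stage_nu_top_isGreatest.{u} hF).1 (stage_nu_top_isGreatest.{u} hG).1
    · exact (stage_nu_top_isGreatest.{u} hF).2 (congrArg Prod.fst hp)
    · exact (stage_nu_top_isGreatest.{u} hG).2 (congrArg Prod.snd hp)
  · exact hnu _

/-- A relation that is closed under joins and preserved by a pair of monotone maps holds between
the approximations of their least fixpoints. -/
theorem stage_mu_rel {F : A → A} {G : B → B} (hF : Monotone F) (hG : Monotone G)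
    {r : A → B → Prop}
    (hSup : ∀ s : Set (A × B), (∀ p ∈ s, r p.1 p.2) → r (sSup s).1 (sSup s).2)
    (step : ∀ a b, a ≤ F a → b ≤ G b → r a b → r (F a) (G b)) (α : WithTop Ordinal.{u}) :
    r (stage F .mu α) (stage G .mu α) := by
  have h := stage_mu_induction (hF.prodMap hG) (p := fun p => r p.1 p.2) hSup
    (fun p hp hr => step p.1 p.2 hp.1 hp.2 hr) α
  rwa [stage_prodMap hF hG] at h

/-- A relation that is closed under meets and preserved by a pair of monotone maps holds between
the approximations of their greatest fixpoints. -/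
theorem stage_nu_rel {F : A → A} {G : B → B} (hF : Monotone F) (hG : Monotone G)
    {r : A → B → Prop}
    (hInf : ∀ s : Set (A × B), (∀ p ∈ s, r p.1 p.2) → r (sInf s).1 (sInf s).2)
    (step : ∀ a b, F a ≤ a → G b ≤ b → r a b → r (F a) (G b)) (α : WithTop Ordinal.{u}) :
    r (stage F .nu α) (stage G .nu α) := by
  have h := stage_nu_induction (hF.prodMap hG) (p := fun p => r p.1 p.2) hInf
    (fun p hp hr => step p.1 p.2 hp.1 hp.2 hr) α
  rwa [stage_prodMap hF hG] at h

end Approximations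

/-! ### A syntactic criterion for guardedness -/

namespace Formula

variable {Act : Type v} {Var : Type w}

/-- A syntactic criterion for guardedness of a formula whose free variables outside `U` occur only
below modalities. In the `j`-th body of a fixpoint formula, only later components may be used
without passing a modality; the components before the entry `i` can only be reached through a
modality, so their bodies may use outer variables freely. -/
def GuardedOver : Formula.{u} Act Var → Set Var → Prop
  | var x, U => x ∈ U
  | top, _ => True
  | bot, _ => True
  | or φ ψ, U => φ.GuardedOver U ∧ ψ.GuardedOver U
  | and φ ψ, U => φ.GuardedOver U ∧ ψ.GuardedOver U
  | fix _ _ x ψ i, U => ∀ j, (ψ j).GuardedOver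
      {y | (∀ k, x k = y → j < k) ∧ ((∃ k, x k = y) ∨ y ∈ U ∨ j < i)}
  | dia _ φ, _ => φ.GuardedOver Set.univ
  | box _ φ, _ => φ.GuardedOver Set.univ

/-- The weight of the edge from a formula to its `k`-th immediate subformula; it is positive if the
subformula cannot be reached by `ε`-transitions. -/
def edgeWeight : Formula.{u} Act Var → ℕ → ℕ
  | fix _ _ _ _ i, k => if k < i then 1 else 0
  | dia _ _, _ => 1
  | box _ _, _ => 1
  | _, _ => 0

/-- The sum of the weights of the edges along a path. -/
def pathWeight : Formula.{u} Act Var → List ℕ → ℕ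
  | _, [] => 0
  | φ, k :: p => φ.edgeWeight k + ((φ.child k).elim 0 fun c => c.pathWeight p)

/-- The number of the `k`-th immediate subformula in an order that, for a fixpoint formula, moves the
components before the entry to the end. -/
def edgeKey : Formula.{u} Act Var → ℕ → ℕ
  | @fix _ _ _ _ n _ _ i, k => if k < i then n + k else k
  | _, k => k

/-- The sequence of the keys of the edges along a path. -/
def pathKey : Formula.{u} Act Var → List ℕ → List ℕ
  | _, [] => []
  | φ, k :: p => φ.edgeKey k :: (φ.child k).elim [] fun c => c.pathKey p

theorem pathKey_lt_append {φ ψ : Formula.{u} Act Var} {p : List ℕ} (h : φ.sub p = some ψ) (k : ℕ) :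
    φ.pathKey p < φ.pathKey (p ++ [k]) := by
  induction p generalizing φ with
  | nil => simp [pathKey]
  | cons l p ih =>
    cases hc : φ.child l with
    | none => simp [sub, hc] at h
    | some c =>
      have h' : c.sub p = some ψ := by simpa [sub, hc] using h
      simpa [pathKey, hc, List.cons_lt_cons_iff] using ih h'

theorem pathWeight_append {φ ψ : Formula.{u} Act Var} {p : List ℕ} (h : φ.sub p = some ψ) (k : ℕ) :
    φ.pathWeight (p ++ [k]) = φ.pathWeight p + ψ.edgeWeight k := by
  induction p generalizing φ with
  | nil =>
    obtain rfl : φ = ψ := by simpa [sub] using h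
    cases hc : φ.child k <;> simp [pathWeight, hc]
  | cons l p ih =>
    cases hc : φ.child l with
    | none => simp [sub, hc] at h
    | some c =>
      have h' : c.sub p = some ψ := by simpa [sub, hc] using h
      simp [pathWeight, hc, ih h', add_assoc]

theorem GuardedOver.child {φ c : Formula.{u} Act Var} {U : Set Var} (h : φ.GuardedOver U) {k : ℕ}
    (hc : φ.child k = some c) : ∃ V, c.GuardedOver V ∧
      ∀ y ∈ V, φ.edgeWeight k = 0 → φ.boundIndex y = none → y ∈ U := by
  cases φ with
  | var x => simp [Formula.child] at hc
  | top => simp [Formula.child] at hc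
  | bot => simp [Formula.child] at hc
  | or φ ψ =>
    refine ⟨U, ?_, fun y hy _ _ => hy⟩
    simp only [Formula.child] at hc
    have := h.1
    have := h.2
    grind
  | and φ ψ =>
    refine ⟨U, ?_, fun y hy _ _ => hy⟩
    simp only [Formula.child] at hc
    have := h.1
    have := h.2
    grind
  | dia τ φ =>
    refine ⟨Set.univ, ?_, fun y _ h => by simp [edgeWeight] at h⟩
    simp only [Formula.child] at hc
    simp only [GuardedOver] at h
    grind
  | box τ φ =>
    refine ⟨Set.univ, ?_, fun y _ h => by simp [edgeWeight] at h⟩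
    simp only [Formula.child] at hc
    simp only [GuardedOver] at h
    grind
  | fix η α x ψ i =>
    simp only [Formula.child] at hc
    split at hc
    · rename_i hk
      obtain rfl := Option.some.inj hc
      refine ⟨_, h ⟨k, hk⟩, fun y hy hw hb => ?_⟩
      have hb' : ¬ ∃ j, x j = y := by simpa [boundIndex] using hb
      have hw' : ¬ k < i := by simpa [edgeWeight] using hw
      rcases hy.2 with h | h | h
      · exact absurd h hb'
      · exact h
      · exact absurd h hw'
    · simp at hc

/-- The restriction to `U` is lifted only below a modality or in a component before the entry, and
both edges have positive weight. -/
theorem GuardedOver.mem_of_pathWeight_eq_zero {φ : Formula.{u} Act Var} {U : Set Var} {y : Var}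
    {p : List ℕ} (h : φ.GuardedOver U) (hp : φ.sub p = some (var y)) (hb : φ.binder y p = none)
    (hw : φ.pathWeight p = 0) : y ∈ U := by
  induction p generalizing φ U with
  | nil =>
    obtain rfl : φ = var y := by simpa [sub] using hp
    exact h
  | cons k p ih =>
    cases hc : φ.child k with
    | none => simp [sub, hc] at hp
    | some c =>
      obtain ⟨V, hV, hVU⟩ := h.child hc
      have hp' : c.sub p = some (var y) := by simpa [sub, hc] using hp
      simp only [pathWeight, hc, Option.elim_some, Nat.add_eq_zero_iff] at hw
      simp only [binder, hc] at hb
      cases hb' : c.binder y p with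
      | some t => simp [hb'] at hb
      | none => exact hVU y (ih hV hp' hb' hw.2) hw.1 (by simpa [hb'] using hb)

/-- This is the only transition that moves upwards in the tree. Going back to an earlier component
is paid for by the weight lost on the way; otherwise the jump goes forward in the order of the keys.
-/
theorem GuardedOver.jump {φ : Formula.{u} Act Var} {U : Set Var} {y : Var}
    {p t : List ℕ} (h : φ.GuardedOver U) (hp : φ.sub p = some (var y))
    (hb : φ.binder y p = some t) :
    φ.pathWeight t < φ.pathWeight p ∨ φ.pathWeight t = φ.pathWeight p ∧ φ.pathKey p < φ.pathKey t := by
  induction p generalizing φ U t with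
  | nil => simp [binder] at hb
  | cons k p ih =>
    cases hc : φ.child k with
    | none => simp [sub, hc] at hp
    | some c =>
      have hp' : c.sub p = some (var y) := by simpa [sub, hc] using hp
      simp only [binder, hc] at hb
      cases hb' : c.binder y p with
      | some s =>
        obtain ⟨V, hV, -⟩ := h.child hc
        obtain rfl : k :: s = t := by simpa [hb'] using hb
        have := ih hV hp' hb'
        simpa [pathWeight, pathKey, hc, List.cons_lt_cons_iff] using this
      | none =>
        simp only [hb'] at hb
        cases φ with
        | @fix η α n x ψ i =>
          simp only [boundIndex] at hb
          split at hb
          · rename_i hy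
            obtain rfl : [(hy.choose : ℕ)] = t := by simpa using hb
            obtain ⟨l, hl, hxl⟩ : ∃ l, hy.choose = l ∧ x l = y := ⟨_, rfl, hy.choose_spec⟩
            rw [hl]
            have hk : k < n := by
              by_contra hk
              simp [Formula.child, hk] at hc
            obtain rfl : ψ ⟨k, hk⟩ = c := by simpa [Formula.child, hk] using hc
            have hmem : (ψ ⟨k, hk⟩).pathWeight p = 0 → k < l := fun hw =>
              ((h ⟨k, hk⟩).mem_of_pathWeight_eq_zero hp' hb' hw).1 l hxl
            have hl' := l.2
            simp only [pathWeight, pathKey, Option.elim_some, edgeWeight, edgeKey,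
              List.cons_lt_cons_iff, Formula.child, dif_pos hl', Nat.add_zero]
            -- If the inner path has weight `0`, then `k < l`: the weight drops when `k < i ≤ l`,
            -- and otherwise it is unchanged and the key grows. If the inner weight is positive, the
            -- total weight drops, except possibly for `l < i ≤ k`, where the weights can agree;
            -- there `k < n + l` decides.
            split_ifs <;> grind
          · simp at hb
        | _ => simp [boundIndex] at hb

theorem loc_eq_inl {φ : Formula.{u} Act Var} {p : List ℕ} {h : (φ.sub p).isSome} {q : φ.State}
    (hq : Sum.inl q = φ.loc p h) : q.1 = p := by
  unfold loc at hq
  split at hq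
  · simp at hq
  · rw [Sum.inl.inj hq]

/-- Descending steps follow edges of weight `0` and extend the key; the jumps from bound variables
are the other case. The lexicographic measure is strict and transitive, which excludes loops. -/
theorem GuardedOver.epsStep {φ : Formula.{u} Act Var} {U : Set Var} (h : φ.GuardedOver U)
    {q q' : φ.State} (hq : φ.automaton.EpsStep q q') :
    φ.pathWeight q'.1 < φ.pathWeight q.1 ∨
      φ.pathWeight q'.1 = φ.pathWeight q.1 ∧ φ.pathKey q.1 < φ.pathKey q'.1 := by
  have hdesc : ∀ {ψ k}, φ.sub q.1 = some ψ → ψ.edgeWeight k = 0 → q'.1 = q.1 ++ [k] →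
      φ.pathWeight q'.1 < φ.pathWeight q.1 ∨
        φ.pathWeight q'.1 = φ.pathWeight q.1 ∧ φ.pathKey q.1 < φ.pathKey q'.1 := by
    intro ψ k hs hw hk
    right
    rw [hk, pathWeight_append hs, hw]
    exact ⟨rfl, pathKey_lt_append hs k⟩
  obtain ⟨S, hS, hmem⟩ := hq
  change φ.delta q = Sum.inl S at hS
  unfold delta at hS
  split at hS
  · exact absurd q.2.1 (by simp [*])
  · obtain rfl := Sum.inl.inj hS
    exact absurd hmem (Set.notMem_empty _)
  · obtain rfl := Sum.inl.inj hS
    exact absurd hmem (Set.notMem_empty _)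
  · obtain rfl := Sum.inl.inj hS
    rcases hmem with hmem | hmem
    · exact hdesc ‹_› rfl (loc_eq_inl hmem)
    · exact hdesc ‹_› rfl (loc_eq_inl hmem)
  · obtain rfl := Sum.inl.inj hS
    rcases hmem with hmem | hmem
    · exact hdesc ‹_› rfl (loc_eq_inl hmem)
    · exact hdesc ‹_› rfl (loc_eq_inl hmem)
  · simp at hS
  · simp at hS
  · obtain rfl := Sum.inl.inj hS
    exact hdesc ‹_› (by simp [edgeWeight]) (loc_eq_inl hmem)
  · obtain rfl := Sum.inl.inj hS
    rw [loc_eq_inl hmem]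
    exact h.jump ‹_› (Option.some_get _).symm

theorem GuardedOver.guarded {φ : Formula.{u} Act Var} {U : Set Var} (h : φ.GuardedOver U) :
    φ.Guarded := by
  intro q hq
  have key : ∀ {q q' : φ.State}, Relation.TransGen φ.automaton.EpsStep q q' →
      φ.pathWeight q'.1 < φ.pathWeight q.1 ∨
        φ.pathWeight q'.1 = φ.pathWeight q.1 ∧ φ.pathKey q.1 < φ.pathKey q'.1 := by
    intro q q' hq
    induction hq with
    | single hs => exact h.epsStep hs
    | tail _ hs ih =>
      have := h.epsStep hs
      rcases ih with h1 | ⟨h1, h2⟩ <;> rcases this with h3 | ⟨h3, h4⟩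
      · exact Or.inl (by omega)
      · exact Or.inl (by omega)
      · exact Or.inl (by omega)
      · exact Or.inr ⟨by omega, h2.trans h4⟩
  rcases key hq with h | h
  · exact lt_irrefl _ h
  · exact lt_irrefl _ h.2

end Formula

/-! ### Reindexing of systems, joins and meets of families of sets -/

theorem stage_reindex {ι κ : Type} {X : Type z} [CompleteLattice X] (e : ι ≃ κ)
    {K : (κ → X) → κ → X} (hK : Monotone K) (η : FixKind) (α : WithTop Ordinal.{u}) :
    stage (fun (H : ι → X) t => K (fun s => H (e.symm s)) (e t)) η α =
      fun t => stage K η α (e t) := by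
  have hK' : Monotone fun (H : ι → X) t => K (fun s => H (e.symm s)) (e t) :=
    fun H H' h t => hK (fun s => h (e.symm s)) (e t)
  have hstep : ∀ (a : ι → X) (b : κ → X), (a = fun t => b (e t)) →
      (fun t => K (fun s => a (e.symm s)) (e t)) = fun t => K b (e t) := by
    rintro _ b rfl
    simp
  cases η
  · refine stage_mu_rel hK' hK (r := fun a b => a = fun t => b (e t)) (fun s hs => ?_)
      (fun a b _ _ h => hstep a b h) α
    funext t
    rw [Prod.fst_sSup, Prod.snd_sSup, sSup_image, sSup_image]
    simp only [iSup_apply]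
    exact iSup_congr fun p => iSup_congr fun hp => congrFun (hs p hp) t
  · refine stage_nu_rel hK' hK (r := fun a b => a = fun t => b (e t)) (fun s hs => ?_)
      (fun a b _ _ h => hstep a b h) α
    funext t
    rw [Prod.fst_sInf, Prod.snd_sInf, sInf_image, sInf_image]
    simp only [iInf_apply]
    exact iInf_congr fun p => iInf_congr fun hp => congrFun (hs p hp) t

section SetFamilies

variable {ι κ : Type} {P Q : Type z}

theorem mem_fst_sSup {s : Set ((ι → Set P) × (κ → Set Q))} {i : ι} {m : P} :
    m ∈ (sSup s).1 i ↔ ∃ p ∈ s, m ∈ p.1 i := by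
  rw [Prod.fst_sSup, sSup_image]
  simp only [iSup_apply, Set.iSup_eq_iUnion, Set.mem_iUnion, exists_prop]

theorem mem_snd_sSup {s : Set ((ι → Set P) × (κ → Set Q))} {i : κ} {m : Q} :
    m ∈ (sSup s).2 i ↔ ∃ p ∈ s, m ∈ p.2 i := by
  rw [Prod.snd_sSup, sSup_image]
  simp only [iSup_apply, Set.iSup_eq_iUnion, Set.mem_iUnion, exists_prop]

theorem mem_fst_sInf {s : Set ((ι → Set P) × (κ → Set Q))} {i : ι} {m : P} :
    m ∈ (sInf s).1 i ↔ ∀ p ∈ s, m ∈ p.1 i := by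
  rw [Prod.fst_sInf, sInf_image]
  simp only [iInf_apply, Set.iInf_eq_iInter, Set.mem_iInter]

theorem mem_snd_sInf {s : Set ((ι → Set P) × (κ → Set Q))} {i : κ} {m : Q} :
    m ∈ (sInf s).2 i ↔ ∀ p ∈ s, m ∈ p.2 i := by
  rw [Prod.snd_sInf, sInf_image]
  simp only [iInf_apply, Set.iInf_eq_iInter, Set.mem_iInter]

end SetFamilies

/-! ### Unfolding a system of equations into copies -/

section Unfolding

variable {Var : Type w} {P : Type z} {n : ℕ}

/-- An operator on pairs of valuations that only depends on the variables in `V`, is monotone, and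
whose value at a point depends on the first valuation only through its value at this point. -/
def PointwiseMono (V : Set Var) (Ψ : (Var → Set P) → (Var → Set P) → Set P) : Prop :=
  ∀ (a a' b b' : Var → Set P) (m : P), (∀ y ∈ V, m ∈ a y → m ∈ a' y) → (∀ y ∈ V, b y ⊆ b' y) →
    m ∈ Ψ a b → m ∈ Ψ a' b'

/-- Components of the unfolding of a system of `n` equations. The component `some (p, S, j)` is a
copy of the `j`-th component, reached by passing through the components in `S` without modalities;
`p` tells whether no modality has been passed since entering the system. The component `none` is
constant. -/
abbrev Copy (n : ℕ) : Type := Option (Bool × Finset (Fin n) × Fin n)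

namespace Copy

/-- The copy that replaces an unguarded variable. -/
def next (p : Bool) (S : Finset (Fin n)) (k : Fin n) : Copy n :=
  if k ∈ S then none else some (p, insert k S, k)

/-- The copy that replaces a guarded variable. -/
def restart (k : Fin n) : Copy n := some (false, {k}, k)

/-- A rank that increases along unguarded dependencies. -/
def rank : Copy n → ℕ
  | none => 2 * n + 2
  | some (p, S, _) => S.card + if p then n + 1 else 0

/-- A new component enlarges `S`, and the constant outranks everything, since `S.card ≤ n` bounds
the other ranks by `2 * n + 1`. The offset `n + 1` places all copies with flag `false` before the
entry `(true, {i}, i)`. -/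
theorem rank_lt_rank_next (p : Bool) (S : Finset (Fin n)) (j k : Fin n) :
    rank (some (p, S, j)) < rank (next p S k) := by
  have := S.card_le_univ
  rw [Fintype.card_fin] at this
  unfold next
  split_ifs with h
  · simp only [rank]
    split_ifs <;> omega
  · simp only [rank, Finset.card_insert_of_notMem h]
    omega

theorem exists_equiv_fin (n : ℕ) : ∃ (N : ℕ) (e : Fin N ≃ Copy n),
    ∀ s t, rank s < rank t → e.symm s < e.symm t := by
  let e₀ := Fintype.equivFin (Copy n)
  refine ⟨_, (Tuple.sort (rank ∘ e₀.symm)).trans e₀.symm, fun s t h => ?_⟩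
  by_contra! hle
  have := Tuple.monotone_sort (rank ∘ e₀.symm) hle
  simp at this
  omega

end Copy

/-- The value of the constant component. -/
def FixKind.const : FixKind → Set P
  | .mu => ∅
  | .nu => Set.univ

/-- The system of equations obtained from the equations `x j = Ψ j` by unfolding. -/
def unfoldMap (η : FixKind) (x : Fin n ↪ Var) (Ψ : Fin n → (Var → Set P) → (Var → Set P) → Set P)
    (a b : Var → Set P) (Y : Copy n → Set P) : Copy n → Set P
  | none => η.const
  | some (p, S, j) => Ψ j (Function.extend x (fun k => Y (Copy.next p S k)) (if p then a else b))
      (Function.extend x (fun k => Y (Copy.restart k)) b)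

variable {x : Fin n ↪ Var} {V : Fin n → Set Var}
  {Ψ : Fin n → (Var → Set P) → (Var → Set P) → Set P}

theorem extend_rel {X : Type z} {r : X → X → Prop} {W : Set Var} {f f' : Fin n → X} {a a' : Var → X}
    (hf : ∀ k, r (f k) (f' k)) (ha : ∀ y ∈ W, (∀ k, x k ≠ y) → r (a y) (a' y)) :
    ∀ y ∈ W, r (Function.extend x f a y) (Function.extend x f' a' y) := by
  intro y hyW
  by_cases hy : ∃ j, x j = y
  · obtain ⟨j, rfl⟩ := hy
    simpa [x.injective.extend_apply] using hf j
  · simpa [Function.extend_apply' _ _ _ hy] using ha y hyW (by simpa using hy)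

theorem unfoldMap_mono (hΨ : ∀ j, PointwiseMono (V j) (Ψ j)) (η : FixKind) (a b : Var → Set P) :
    Monotone (unfoldMap η x Ψ a b) := by
  rintro Y Y' hY (_ | ⟨p, S, j⟩)
  · exact le_rfl
  · intro m hm
    refine hΨ j _ _ _ _ m (extend_rel (r := fun A B => m ∈ A → m ∈ B) (fun k h => hY _ h)
      fun y _ _ h => h) (extend_rel (r := fun A B : Set P => A ⊆ B) (fun k => hY _) fun y _ _ => subset_rfl) hm

/-- This keeps `PointwiseMono` alive through a fixpoint. Copies with flag `false` never read `a`, so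
they are compared at all points; copies with flag `true` are compared at `m` only. That suffices,
because their guarded calls restart with flag `false` and their unguarded calls stay at `m`. -/
theorem stage_unfoldMap_rel (hΨ : ∀ j, PointwiseMono (V j) (Ψ j)) (η : FixKind)
    (α : WithTop Ordinal.{u}) {a a' b b' : Var → Set P} {m : P}
    (ha : ∀ j, ∀ y ∈ V j, (∀ k, x k ≠ y) → m ∈ a y → m ∈ a' y)
    (hb : ∀ j, ∀ y ∈ V j, (∀ k, x k ≠ y) → b y ⊆ b' y) (s : Copy n)
    (hm : m ∈ stage (unfoldMap η x Ψ a b) η α s) : m ∈ stage (unfoldMap η x Ψ a' b') η α s := by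
  let r : (Copy n → Set P) → (Copy n → Set P) → Prop := fun Y Y' =>
    (∀ s, m ∈ Y s → m ∈ Y' s) ∧ Y none ⊆ Y' none ∧ ∀ S j, Y (some (false, S, j)) ⊆ Y' (some (false, S, j))
  have hstep : ∀ Y Y', r Y Y' → r (unfoldMap η x Ψ a b Y) (unfoldMap η x Ψ a' b' Y') := by
    rintro Y Y' ⟨h1, h2, h3⟩
    refine ⟨?_, subset_rfl, ?_⟩
    · rintro (_ | ⟨p, S, j⟩)
      · exact id
      · refine hΨ j _ _ _ _ m (extend_rel (r := fun A B => m ∈ A → m ∈ B) (fun k => h1 _) ?_)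
          (extend_rel (r := fun A B : Set P => A ⊆ B) (fun k => h3 _ _) (hb j))
        intro y hy hxy
        cases p
        · exact fun h => hb j y hy hxy h
        · exact ha j y hy hxy
    · intro S j m'
      refine hΨ j _ _ _ _ m' (extend_rel (r := fun A B => m' ∈ A → m' ∈ B) (fun k => ?_) ?_)
          (extend_rel (r := fun A B : Set P => A ⊆ B) (fun k => h3 _ _) (hb j))
      · unfold Copy.next
        split_ifs
        · exact fun h => h2 h
        · exact fun h => h3 _ _ h
      · exact fun y hy hxy h => hb j y hy hxy h
  have hF := unfoldMap_mono (x := x) hΨ η a b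
  have hG := unfoldMap_mono (x := x) hΨ η a' b'
  suffices h : r (stage (unfoldMap η x Ψ a b) η α) (stage (unfoldMap η x Ψ a' b') η α) from
    h.1 s hm
  cases η
  · refine stage_mu_rel hF hG (fun s hs => ?_) (fun Y Y' _ _ h => hstep Y Y' h) α
    refine ⟨fun t => ?_, fun m' => ?_, fun S j m' => ?_⟩ <;>
      rw [mem_fst_sSup, mem_snd_sSup] <;> rintro ⟨p, hp, h⟩
    · exact ⟨p, hp, (hs p hp).1 t h⟩
    · exact ⟨p, hp, (hs p hp).2.1 h⟩
    · exact ⟨p, hp, (hs p hp).2.2 S j h⟩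
  · refine stage_nu_rel hF hG (fun s hs => ?_) (fun Y Y' _ _ h => hstep Y Y' h) α
    refine ⟨fun t => ?_, fun m' => ?_, fun S j m' => ?_⟩ <;>
      rw [mem_fst_sInf, mem_snd_sInf] <;> intro h p hp
    · exact (hs p hp).1 t (h p hp)
    · exact (hs p hp).2.1 (h p hp)
    · exact (hs p hp).2.2 S j (h p hp)

/-- The copies are at least as large as the original components. Conversely, a copy with memory `S`
is correct at those points that lie in all the other components of `S`; for `S = {i}` this is no
condition. -/
theorem stage_nu_unfoldMap (hΨ : ∀ j, PointwiseMono (V j) (Ψ j)) (α : WithTop Ordinal.{u})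
    (v : Var → Set P) (q : Bool) (i : Fin n) :
    stage (unfoldMap .nu x Ψ v v) .nu α (some (q, {i}, i)) =
      stage (fun (H : Fin n → Set P) j => Ψ j (Function.extend x H v) (Function.extend x H v))
        .nu α i := by
  have hF : Monotone fun (H : Fin n → Set P) j =>
      Ψ j (Function.extend x H v) (Function.extend x H v) := fun H H' hH j m =>
    hΨ j _ _ _ _ m (extend_rel (r := fun A B => m ∈ A → m ∈ B) (fun k h => hH k h) fun y _ _ h => h)
      (extend_rel (r := fun A B : Set P => A ⊆ B) (fun k => hH k) fun y _ _ => subset_rfl)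
  have h := stage_nu_rel hF (unfoldMap_mono (x := x) hΨ .nu v v)
    (r := fun Z Y => Y none = Set.univ ∧ (∀ p S j, Z j ⊆ Y (some (p, S, j))) ∧
      ∀ p S j m, m ∈ Y (some (p, S, j)) → (∀ s ∈ S, s ≠ j → m ∈ Z s) → m ∈ Z j) ?_ ?_ α
  · exact Set.Subset.antisymm (fun m hm => h.2.2 _ _ _ m hm fun s hs hsj =>
      absurd (Finset.mem_singleton.1 hs) hsj) (h.2.1 _ _ _)
  · intro s hs
    refine ⟨Set.eq_univ_of_forall fun m => ?_, fun p S j m => ?_, fun p S j m => ?_⟩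
    · rw [mem_snd_sInf]
      intro p hp
      rw [(hs p hp).1]
      trivial
    · rw [mem_fst_sInf, mem_snd_sInf]
      exact fun h q hq => (hs q hq).2.1 p S j (h q hq)
    · simp only [mem_fst_sInf, mem_snd_sInf]
      exact fun h h' q hq => (hs q hq).2.2 p S j m (h q hq) fun s hs hsj => h' s hs hsj q hq
  · rintro Z Y hZ hY ⟨h1, h2, h3⟩
    refine ⟨rfl, fun p S j m => ?_, fun p S j m hm hS => ?_⟩
    · refine hΨ j _ _ _ _ m (extend_rel (r := fun A B => m ∈ A → m ∈ B) (fun k hk => ?_) ?_)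
        (extend_rel (r := fun A B : Set P => A ⊆ B) (fun k => h2 _ _ _) fun y _ _ => subset_rfl)
      · unfold Copy.next
        split_ifs
        · rw [h1]; trivial
        · exact h2 _ _ _ hk
      · simp
    · have hmS : ∀ s ∈ S, s ≠ j → m ∈ Z s := fun s hs hsj => hZ s (hS s hs hsj)
      -- Stages decrease, so `m` was already in the copy at the previous stage. Hence `m` lies in `Z
      -- s` for every `s ∈ S`, and replacing the calls of these components by the full set changes
      -- nothing at `m`.
      have hmj : m ∈ Z j := h3 p S j m (hY _ hm) hmS
      refine hΨ j _ _ _ _ m (extend_rel (r := fun A B => m ∈ A → m ∈ B) (fun k => ?_) ?_)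
        (extend_rel (r := fun A B : Set P => A ⊆ B) (fun k m' hm' => h3 _ _ _ m' hm' fun s hs hsj =>
          absurd (Finset.mem_singleton.1 hs) hsj) fun y _ _ => subset_rfl) hm
      · have hmem : ∀ s ∈ S, m ∈ Z s := fun s hs => by
          by_cases hsj : s = j
          · rwa [hsj]
          · exact hmS s hs hsj
        unfold Copy.next
        split_ifs with hk
        · exact fun _ => hmem k hk
        · exact fun h => h3 _ _ _ m h fun s hs hsk => hmem s (Finset.mem_of_mem_insert_of_ne hs hsk)
      · simp

/-- Dually, a copy with memory `S` is correct at those points that lie in no other component of `S`.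
-/
theorem stage_mu_unfoldMap (hΨ : ∀ j, PointwiseMono (V j) (Ψ j)) (α : WithTop Ordinal.{u})
    (v : Var → Set P) (q : Bool) (i : Fin n) :
    stage (unfoldMap .mu x Ψ v v) .mu α (some (q, {i}, i)) =
      stage (fun (H : Fin n → Set P) j => Ψ j (Function.extend x H v) (Function.extend x H v))
        .mu α i := by
  have hF : Monotone fun (H : Fin n → Set P) j =>
      Ψ j (Function.extend x H v) (Function.extend x H v) := fun H H' hH j m =>
    hΨ j _ _ _ _ m (extend_rel (r := fun A B => m ∈ A → m ∈ B) (fun k h => hH k h) fun y _ _ h => h)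
      (extend_rel (r := fun A B : Set P => A ⊆ B) (fun k => hH k) fun y _ _ => subset_rfl)
  have h := stage_mu_rel hF (unfoldMap_mono (x := x) hΨ .mu v v)
    (r := fun Z Y => Y none = ∅ ∧ (∀ p S j, Y (some (p, S, j)) ⊆ Z j) ∧
      ∀ p S j m, m ∈ Z j → (∀ s ∈ S, s ≠ j → m ∉ Z s) → m ∈ Y (some (p, S, j))) ?_ ?_ α
  · exact Set.Subset.antisymm (h.2.1 _ _ _) (fun m hm => h.2.2 _ _ _ m hm fun s hs hsj =>
      absurd (Finset.mem_singleton.1 hs) hsj)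
  · intro s hs
    refine ⟨Set.eq_empty_of_forall_notMem fun m => ?_, fun p S j m => ?_, fun p S j m => ?_⟩
    · rw [mem_snd_sSup]
      rintro ⟨p, hp, h⟩
      rw [(hs p hp).1] at h
      exact h
    · rw [mem_fst_sSup, mem_snd_sSup]
      exact fun ⟨q, hq, h⟩ => ⟨q, hq, (hs q hq).2.1 p S j h⟩
    · simp only [mem_fst_sSup, mem_snd_sSup]
      exact fun ⟨q, hq, h⟩ h' => ⟨q, hq, (hs q hq).2.2 p S j m h fun s hs hsj hm =>
        h' s hs hsj ⟨q, hq, hm⟩⟩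
  · rintro Z Y hZ hY ⟨h1, h2, h3⟩
    refine ⟨rfl, fun p S j m => ?_, fun p S j m hm hS => ?_⟩
    · refine hΨ j _ _ _ _ m (extend_rel (r := fun A B => m ∈ A → m ∈ B) (fun k => ?_) ?_)
        (extend_rel (r := fun A B : Set P => A ⊆ B) (fun k => h2 _ _ _) fun y _ _ => subset_rfl)
      · unfold Copy.next
        split_ifs
        · rw [h1]; exact False.elim
        · exact fun hk => h2 _ _ _ hk
      · simp
    -- This separates off the case that `m` was in `Z j` before, where the previous stage of the
    -- copy already contains `m`. In the remaining case `m` enters `j` just now and lies in no `Z s`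
    -- with `s ∈ S`, so emptying these calls loses nothing at `m`.
    · by_contra hnot
      have hmS : ∀ s ∈ S, s ≠ j → m ∉ Z s := fun s hs hsj h => hS s hs hsj (hZ s h)
      have hmj : m ∉ Z j := fun h => hnot (hY _ (h3 p S j m h hmS))
      refine hnot (hΨ j _ _ _ _ m (extend_rel (r := fun A B => m ∈ A → m ∈ B) (fun k => ?_) ?_)
        (extend_rel (r := fun A B : Set P => A ⊆ B) (fun k m' hm' => h3 _ _ _ m' hm' fun s hs hsj =>
          absurd (Finset.mem_singleton.1 hs) hsj) fun y _ _ => subset_rfl) hm)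
      · have hmem : ∀ s ∈ S, m ∉ Z s := fun s hs => by
          by_cases hsj : s = j
          · rwa [hsj]
          · exact hmS s hs hsj
        unfold Copy.next
        split_ifs with hk
        · exact fun h => absurd h (hmem k hk)
        · exact fun h => h3 _ _ _ m h fun s hs hsk => hmem s (Finset.mem_of_mem_insert_of_ne hs hsk)
      · simp

theorem stage_unfoldMap (hΨ : ∀ j, PointwiseMono (V j) (Ψ j)) (η : FixKind)
    (α : WithTop Ordinal.{u}) (v : Var → Set P) (q : Bool) (i : Fin n) :
    stage (unfoldMap η x Ψ v v) η α (some (q, {i}, i)) =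
      stage (fun (H : Fin n → Set P) j => Ψ j (Function.extend x H v) (Function.extend x H v))
        η α i := by
  cases η
  · exact stage_mu_unfoldMap hΨ α v q i
  · exact stage_nu_unfoldMap hΨ α v q i

end Unfolding

/-! ### Separating guarded from unguarded occurrences, by induction on formulas -/

namespace Formula

variable {Act : Type v} {Var : Type w}

/-- `Ψ` is a semantics of `φ` that reads unguarded and guarded occurrences of free variables in two
different valuations, and that is definable by formulas in which only the variables
of the first valuation are unguarded, for all choices of the names of the variables. -/
structure IsSplitting (φ : Formula.{u} Act Var) (V : Set Var)
    (Ψ : ∀ M : Model.{v, z} Act, (Var → Set M.Point) → (Var → Set M.Point) → Set M.Point) :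
    Prop where
  finite : V.Finite
  diag : ∀ M val, Ψ M val val = φ.sem M val
  mono : ∀ M, PointwiseMono V (Ψ M)
  exists_formula : ∀ (a b : Var → Var) (U : Set Var), (∀ y ∈ V, a y ∈ U) →
    ∃ ψ : Formula.{u} Act Var, ψ.GuardedOver U ∧
      ∀ M val, ψ.sem M val = Ψ M (fun y => val (a y)) fun y => val (b y)

theorem PointwiseMono.congr {P : Type z} {V : Set Var}
    {Ψ : (Var → Set P) → (Var → Set P) → Set P} (hΨ : PointwiseMono V Ψ)
    {a a' b b' : Var → Set P} (ha : ∀ y ∈ V, a y = a' y) (hb : ∀ y ∈ V, b y = b' y) :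
    Ψ a b = Ψ a' b' :=
  Set.ext fun m => ⟨hΨ a a' b b' m (fun y hy h => ha y hy ▸ h)
      (fun y hy => (hb y hy).subset),
    hΨ a' a b' b m (fun y hy h => (ha y hy).symm ▸ h) (fun y hy => (hb y hy).symm.subset)⟩

/-- Quantifying over renamings in `exists_formula` lets the same body be instantiated once per copy,
with different names for the unguarded and the guarded occurrences of each bound variable. -/
theorem IsSplitting.fix [Infinite Var] (η : FixKind) (α : WithTop Ordinal.{u}) {n : ℕ}
    (x : Fin n ↪ Var) {ψ : Fin n → Formula.{u} Act Var} (i : Fin n) {V : Fin n → Set Var}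
    {Ψ : Fin n → ∀ M : Model.{v, z} Act,
      (Var → Set M.Point) → (Var → Set M.Point) → Set M.Point}
    (h : ∀ j, (ψ j).IsSplitting (V j) (Ψ j)) :
    (fix η α x ψ i).IsSplitting ((⋃ j, V j) \ Set.range x) fun M a b =>
      stage (unfoldMap η x (fun j => Ψ j M) a b) η α (some (true, {i}, i)) where
  finite := (Set.finite_iUnion fun j => (h j).finite).sdiff
  diag M val := by
    rw [stage_unfoldMap fun j => (h j).mono M]
    simp only [(h _).diag]
    rfl
  mono M a a' b b' m ha hb := by
    have hmem : ∀ j, ∀ y ∈ V j, (∀ k, x k ≠ y) → y ∈ (⋃ j, V j) \ Set.range x :=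
      fun j y hy hxy => ⟨Set.mem_iUnion_of_mem j hy, fun ⟨k, hk⟩ => hxy k hk⟩
    exact stage_unfoldMap_rel (fun j => (h j).mono M) η α
      (fun j y hy hxy => ha y (hmem j y hy hxy)) (fun j y hy hxy => hb y (hmem j y hy hxy)) _
  exists_formula a b U hU := by
    set W := (⋃ j, V j) \ Set.range x
    have hWf : W.Finite := (Set.finite_iUnion fun j => (h j).finite).sdiff
    have hmem : ∀ j, ∀ y ∈ V j, (¬ ∃ k, x k = y) → y ∈ W :=
      fun j y hy hxy => ⟨Set.mem_iUnion_of_mem j hy, hxy⟩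
    obtain ⟨N, e, he⟩ := Copy.exists_equiv_fin n
    -- The names of the copies are chosen outside the images of the free variables under both
    -- renamings, so that no free variable is captured.
    have hinf : (a '' W ∪ b '' W)ᶜ.Infinite := ((hWf.image a).union (hWf.image b)).infinite_compl
    have := hinf.to_subtype
    let x₀ : Fin N ↪ ((a '' W ∪ b '' W)ᶜ : Set Var) :=
      Fin.valEmbedding.trans (Infinite.natEmbedding _)
    let y : Fin N ↪ Var := x₀.trans (Function.Embedding.subtype _)
    have hya : ∀ w ∈ W, ¬ ∃ t, y t = a w := by
      rintro w hw ⟨t, ht⟩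
      exact (x₀ t).2 (Or.inl ⟨w, hw, ht.symm⟩)
    have hyb : ∀ w ∈ W, ¬ ∃ t, y t = b w := by
      rintro w hw ⟨t, ht⟩
      exact (x₀ t).2 (Or.inr ⟨w, hw, ht.symm⟩)
    let en : Fin N := e.symm (some (true, {i}, i))
    let name : Copy n → Var := fun s => y (e.symm s)
    have hbody : ∀ t, ∃ χ : Formula.{u} Act Var,
        χ.GuardedOver {z | (∀ k, y k = z → t < k) ∧ ((∃ k, y k = z) ∨ z ∈ U ∨ t < en)} ∧
        ∀ M val (H : Fin N → Set M.Point), χ.sem M (Function.extend y H val) =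
          unfoldMap η x (fun j => Ψ j M) (fun z => val (a z)) (fun z => val (b z))
            (fun s => H (e.symm s)) (e t) := by
      intro t
      obtain ⟨s, rfl⟩ := e.symm.surjective t
      rw [e.apply_symm_apply]
      rcases s with _ | ⟨p, S, j⟩
      · cases η
        · exact ⟨bot, trivial, fun M val H => rfl⟩
        · exact ⟨top, trivial, fun M val H => rfl⟩
      · let f : Var → Var :=
          Function.extend x (fun k => name (Copy.next p S k)) (if p then a else b)
        have hf : ∀ z ∈ V j, f z ∈ {z | (∀ k, y k = z → e.symm (some (p, S, j)) < k) ∧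
            ((∃ k, y k = z) ∨ z ∈ U ∨ e.symm (some (p, S, j)) < en)} := by
          intro z hz
          simp only [f]
          by_cases hx : ∃ k, x k = z
          · obtain ⟨k, rfl⟩ := hx
            rw [x.injective.extend_apply]
            refine ⟨fun l hl => ?_, Or.inl ⟨_, rfl⟩⟩
            rw [y.injective hl]
            exact he _ _ (Copy.rank_lt_rank_next p S j k)
          · rw [Function.extend_apply' _ _ _ hx]
            have hzW := hmem j z hz hx
            cases p
            -- A copy with flag `false` lies before the entry, since its rank is at most `n` and
            -- that of the entry is `n + 2`. Hence the criterion lets it use outer variables that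
            -- are not in `U`.
            · refine ⟨fun l hl => absurd ⟨l, hl⟩ (hyb z hzW), Or.inr (Or.inr (he _ _ ?_))⟩
              have := S.card_le_univ
              rw [Fintype.card_fin] at this
              simp [Copy.rank]
              omega
            · exact ⟨fun l hl => absurd ⟨l, hl⟩ (hya z hzW), Or.inr (Or.inl (hU z hzW))⟩
        obtain ⟨χ, hχ, hsem⟩ := (h j).exists_formula f
          (Function.extend x (fun k => name (Copy.restart k)) b) _ hf
        refine ⟨χ, hχ, fun M val H => (hsem M _).trans ?_⟩
        refine PointwiseMono.congr ((h j).mono M) (fun z hz => ?_) fun z hz => ?_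
        · simp only [f]
          by_cases hx : ∃ k, x k = z
          · obtain ⟨k, rfl⟩ := hx
            simp [x.injective.extend_apply, name, y.injective.extend_apply]
          · rw [Function.extend_apply' _ _ _ hx, Function.extend_apply' _ _ _ hx]
            cases p
            · exact Function.extend_apply' _ _ _ (hyb z (hmem j z hz hx))
            · exact Function.extend_apply' _ _ _ (hya z (hmem j z hz hx))
        · by_cases hx : ∃ k, x k = z
          · obtain ⟨k, rfl⟩ := hx
            simp [x.injective.extend_apply, name, y.injective.extend_apply]
          · rw [Function.extend_apply' _ _ _ hx, Function.extend_apply' _ _ _ hx]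
            exact Function.extend_apply' _ _ _ (hyb z (hmem j z hz hx))
    choose χ hχ hsem using hbody
    refine ⟨Formula.fix η α y χ en, fun t => hχ t, fun M val => ?_⟩
    simp only [sem, hsem]
    rw [stage_reindex e (unfoldMap_mono (fun j => (h j).mono M) η _ _)]
    simp [en]

theorem exists_isSplitting [Infinite Var] (φ : Formula.{u} Act Var) :
    ∃ V Ψ, IsSplitting.{u, v, w, z} φ V Ψ := by
  induction φ with
  | var x =>
    refine ⟨{x}, fun M a _ => a x, Set.finite_singleton x, fun M val => rfl,
      fun M a a' b b' m ha _ hm => ha x rfl hm, fun a b U hU => ⟨var (a x), hU x rfl, fun M val => rfl⟩⟩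
  | top =>
    exact ⟨∅, fun M _ _ => Set.univ, Set.finite_empty, fun M val => rfl,
      fun M a a' b b' m _ _ hm => hm, fun a b U hU => ⟨top, trivial, fun M val => rfl⟩⟩
  | bot =>
    exact ⟨∅, fun M _ _ => ∅, Set.finite_empty, fun M val => rfl,
      fun M a a' b b' m _ _ hm => hm, fun a b U hU => ⟨bot, trivial, fun M val => rfl⟩⟩
  | or φ ψ h₁ h₂ =>
    obtain ⟨V₁, Ψ₁, h₁⟩ := h₁
    obtain ⟨V₂, Ψ₂, h₂⟩ := h₂
    refine ⟨V₁ ∪ V₂, fun M a b => Ψ₁ M a b ∪ Ψ₂ M a b, h₁.finite.union h₂.finite,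
      fun M val => congrArg₂ _ (h₁.diag M val) (h₂.diag M val),
      fun M a a' b b' m ha hb hm => ?_, fun a b U hU => ?_⟩
    · exact hm.imp
        (h₁.mono M _ _ _ _ m (fun y hy => ha y (.inl hy)) fun y hy => hb y (.inl hy))
        (h₂.mono M _ _ _ _ m (fun y hy => ha y (.inr hy)) fun y hy => hb y (.inr hy))
    · obtain ⟨χ₁, hχ₁, hs₁⟩ := h₁.exists_formula a b U fun y hy => hU y (.inl hy)
      obtain ⟨χ₂, hχ₂, hs₂⟩ := h₂.exists_formula a b U fun y hy => hU y (.inr hy)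
      exact ⟨or χ₁ χ₂, ⟨hχ₁, hχ₂⟩, fun M val => congrArg₂ _ (hs₁ M val) (hs₂ M val)⟩
  | and φ ψ h₁ h₂ =>
    obtain ⟨V₁, Ψ₁, h₁⟩ := h₁
    obtain ⟨V₂, Ψ₂, h₂⟩ := h₂
    refine ⟨V₁ ∪ V₂, fun M a b => Ψ₁ M a b ∩ Ψ₂ M a b, h₁.finite.union h₂.finite,
      fun M val => congrArg₂ _ (h₁.diag M val) (h₂.diag M val),
      fun M a a' b b' m ha hb hm => ?_, fun a b U hU => ?_⟩
    · exact hm.imp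
        (h₁.mono M _ _ _ _ m (fun y hy => ha y (.inl hy)) fun y hy => hb y (.inl hy))
        (h₂.mono M _ _ _ _ m (fun y hy => ha y (.inr hy)) fun y hy => hb y (.inr hy))
    · obtain ⟨χ₁, hχ₁, hs₁⟩ := h₁.exists_formula a b U fun y hy => hU y (.inl hy)
      obtain ⟨χ₂, hχ₂, hs₂⟩ := h₂.exists_formula a b U fun y hy => hU y (.inr hy)
      exact ⟨and χ₁ χ₂, ⟨hχ₁, hχ₂⟩, fun M val => congrArg₂ _ (hs₁ M val) (hs₂ M val)⟩
  | fix η α x ψ i ih =>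
    choose V Ψ h using ih
    exact ⟨_, _, IsSplitting.fix η α x i h⟩
  | dia τ φ h =>
    obtain ⟨V, Ψ, h⟩ := h
    -- Below a modality every occurrence is guarded, so the second valuation is used in both places.
    refine ⟨V, fun M _ b => {m | ∃ n, M.step τ m n ∧ n ∈ Ψ M b b}, h.finite,
      fun M val => by simp only [h.diag, sem], fun M a a' b b' m _ hb hm => ?_, fun a b U _ => ?_⟩
    · obtain ⟨n, hn, hm⟩ := hm
      exact ⟨n, hn, h.mono M _ _ _ _ n (fun y hy h => hb y hy h) hb hm⟩
    · obtain ⟨χ, hχ, hs⟩ := h.exists_formula b b Set.univ fun y _ => trivial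
      exact ⟨dia τ χ, hχ, fun M val => by simp only [sem, hs]⟩
  | box τ φ h =>
    obtain ⟨V, Ψ, h⟩ := h
    refine ⟨V, fun M _ b => {m | ∀ n, M.step τ m n → n ∈ Ψ M b b}, h.finite,
      fun M val => by simp only [h.diag, sem], fun M a a' b b' m _ hb hm => ?_, fun a b U _ => ?_⟩
    · exact fun n hn => h.mono M _ _ _ _ n (fun y hy h => hb y hy h) hb (hm n hn)
    · obtain ⟨χ, hχ, hs⟩ := h.exists_formula b b Set.univ fun y _ => trivial
      exact ⟨box τ χ, hχ, fun M val => by simp only [sem, hs]⟩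

end Formula

end CountdownCalculus

theorem mainTheorem6 {Act : Type v} {Var : Type w} [Infinite Var]
    (φ : CountdownCalculus.Formula.{u, v, w} Act Var) :
    ∃ ψ : CountdownCalculus.Formula.{u, v, w} Act Var,
      ψ.Guarded ∧ CountdownCalculus.Formula.Equivalent.{u, v, w, z} φ ψ := by
  obtain ⟨V, Ψ, h⟩ := φ.exists_isSplitting
  obtain ⟨ψ, hψ, hsem⟩ := h.exists_formula id id Set.univ fun y _ => trivial
  exact ⟨ψ, hψ.guarded, fun M val => (h.diag M val).symm.trans (hsem M val).symm⟩
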